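/- Let $R=\mathbb{Z}_2+u\mathbb{Z}_2$ with $u^2=0$, and let $\alpha,\beta\ge 0$ be integers with $\alpha+\beta>0$. Regard $\mathbb{Z}_2^\alpha\times R^\beta$ as an $R$-module, where $r+uq\in R$ acts on the binary coordinates as multiplication by $r$. Define the $R$-valued inner product $$\langle (a,b),(d,e)\rangle=u\sum_i a_id_i+\sum_j b_je_j ,$$ and let $\mathcal{C}^\perp$ be the dual of a submodule $\mathcal{C}$ with respect to it. A $\mathbb{Z}_2\mathbb{Z}_2[u]$-cyclic code is an $R$-submodule $\mathcal{C}$ that is closed under the simultaneous cyclic shift of the binary block and of the $R$-block. It is self-orthogonal if $\mathcal{C}\subseteq\mathcal{C}^\perp$. It has type $(\alpha,\beta;k_0,k_1,k_2)$ if, as an abelian group, $\mathcal{C}\cong\mathbb{Z}_2^{k_0+k_2}\times\mathbb{Z}_2^{2k_1}$. The weight of a word is the Hamming weight of its binary part plus the Lee weight of its $R$-part, the elements $0,1,u,1+u$ having Lee weights $0,1,2,1$. The Gray map $\Phi:\mathbb{Z}_2^\alpha\times R^\beta\to\mathbb{Z}_2^{\alpha+2\beta}$ is $\Phi(x,\,r+uq)=(x,\,q,\,r+q)$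 for $x\in\mathbb{Z}_2^\alpha$ and $r,q\in\mathbb{Z}_2^\beta$. A stabilizer code on $N$ qubits is the joint $+1$-eigenspace in $(\mathbb{C}^2)^{\otimes N}$ of an abelian subgroup, not containing $-1$, of the Pauli group. It is an $[[N,k,d]]$ code if its dimension is $2^k$ and $d$ is its minimum distance, that is, the least weight of a Pauli error which it does not detect; here $Q$ detects $E$ if, for some constant $c_E$, $\langle\varphi|E|\psi\rangle=c_E\langle\varphi|\psi\rangle$ for all $\varphi,\psi\in Q$. For $k=0$, by the usual convention, $d$ is the least weight of a Pauli error of positive weight that does not map the code into its orthogonal complement. A code is pure to $t$ if every Pauli error of weight $1,\dots,t-1$ maps it into its orthogonal complement. For binary linear codes $C_2\subseteq C_1$, the CSS code of $(C_1,C_2)$ is the span of the states $\sum_{y\in C_2}|x+y\rangle$, $x\in C_1$. **Theorem.** Let $\mathcal{C}$ be a self-orthogonal $\mathbb{Z}_2\mathbb{Z}_2[u]$-cyclic code of type $(\alpha,\beta;k_0,k_1,k_2)$. Put $N=\alpha+2\beta$ and $K=k_0+k_2+2k_1$, and let $d^\perp$ be the minimum distance of $\mathcal{C}^\perp$. Then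 $2K\le N$, and there exists an $[[N,\,N-2K,\,d^\perp]]$ stabilizer code. Moreover $\Phi(\mathcal{C})\subseteq\Phi(\mathcal{C}^\perp)$, and the CSS code of $(\Phi(\mathcal{C}^\perp),\Phi(\mathcal{C}))$ is an $[[N,\,N-2K,\,d]]$ stabilizer code, for some $d\ge d^\perp$, that is pure to $d^\perp$. -/

import Mathlib

/-! ### Codes over `ℤ₂^α × R^β`, where `R = ℤ₂ + uℤ₂`, `u² = 0` -/

namespace Z2Z2u

/-- The four-element ring `R = ℤ₂ + uℤ₂` with `u² = 0`; `fst` and `snd` of `r + uq` are `r`, `q`. -/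
abbrev R : Type := DualNumber (ZMod 2)

/-- The element `u` of `R`. -/
abbrev u : R := DualNumber.eps

/-- The words `(a₀ … a_{α-1}, b₀ … b_{β-1})` of `ℤ₂^α × R^β`. -/
def Word (α β : ℕ) : Type := (Fin α → ZMod 2) × (Fin β → R)

variable {α β : ℕ}

instance instAddCommGroupWord : AddCommGroup (Word α β) :=
  inferInstanceAs (AddCommGroup ((Fin α → ZMod 2) × (Fin β → R)))

/-- `R` acts on the binary coordinates through reduction modulo `u`, that is
`(r + uq) • a = r * a`, and on the other coordinates by multiplication. -/
instance instModuleWord : Module R (Word α β) where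
  smul r v := (fun i => r.fst * v.1 i, fun j => r * v.2 j)
  one_smul _ := Prod.ext (funext fun _ => one_mul _) (funext fun _ => one_mul _)
  mul_smul r s v := Prod.ext
    (funext fun i => (congrArg (· * v.1 i) (TrivSqZeroExt.fst_mul r s)).trans (mul_assoc _ _ _))
    (funext fun _ => mul_assoc _ _ _)
  smul_zero _ := Prod.ext (funext fun _ => mul_zero _) (funext fun _ => mul_zero _)
  smul_add _ _ _ := Prod.ext (funext fun _ => mul_add _ _ _) (funext fun _ => mul_add _ _ _)
  add_smul _ _ _ := Prod.ext (funext fun _ => add_mul _ _ _) (funext fun _ => add_mul _ _ _)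
  zero_smul _ := Prod.ext (funext fun _ => zero_mul _) (funext fun _ => zero_mul _)

theorem smul_fst (r : R) (v : Word α β) (i : Fin α) : (r • v).1 i = r.fst * v.1 i := rfl

theorem smul_snd (r : R) (v : Word α β) (j : Fin β) : (r • v).2 j = r * v.2 j := rfl

theorem zero_fst (i : Fin α) : (0 : Word α β).1 i = 0 := rfl

theorem zero_snd (j : Fin β) : (0 : Word α β).2 j = 0 := rfl

theorem add_fst (v w : Word α β) (i : Fin α) : (v + w).1 i = v.1 i + w.1 i := rfl

theorem add_snd (v w : Word α β) (j : Fin β) : (v + w).2 j = v.2 j + w.2 j := rfl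

/-- A `ℤ₂ℤ₂[u]`-linear code: an `R`-submodule of `ℤ₂^α × R^β`. -/
abbrev Code (α β : ℕ) : Type := Submodule R (Word α β)

/-- The inner product `u ∑ aᵢ dᵢ + ∑ bⱼ eⱼ`, with values in `R`. -/
def innerProd (V W : Word α β) : R :=
  u * TrivSqZeroExt.inl (∑ i, V.1 i * W.1 i) + ∑ j, V.2 j * W.2 j

theorem innerProd_zero (V : Word α β) : innerProd V 0 = 0 := by
  simp [innerProd, zero_fst, zero_snd]

theorem innerProd_add (V W W' : Word α β) :
    innerProd V (W + W') = innerProd V W + innerProd V W' := by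
  simp only [innerProd, add_fst, add_snd, mul_add,
    Finset.sum_add_distrib, TrivSqZeroExt.inl_add]
  abel

theorem innerProd_smul (r : R) (V W : Word α β) :
    innerProd V (r • W) = r * innerProd V W := by
  have h : ∀ s : ZMod 2, u * TrivSqZeroExt.inl (r.fst * s) = r * (u * TrivSqZeroExt.inl s) := by
    intro s
    ext <;> simp
  simp only [innerProd, smul_fst, smul_snd, mul_add, Finset.mul_sum, mul_left_comm _ r]
  congr 1
  rw [← h, Finset.mul_sum]
  simp only [mul_left_comm]

/-- The dual code `C^⊥`. -/
def dual (C : Code α β) : Code α β where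
  carrier := {W | ∀ V ∈ C, innerProd V W = 0}
  zero_mem' := fun V _ => innerProd_zero V
  add_mem' := fun {W W'} hW hW' V hV => by rw [innerProd_add, hW V hV, hW' V hV, add_zero]
  smul_mem' := fun r W hW V hV => by rw [innerProd_smul, hW V hV, mul_zero]

/-- Self-orthogonality, `C ⊆ C^⊥`. -/
def IsSelfOrthogonal (C : Code α β) : Prop := C ≤ dual C

/-- The shift `(a_{α-1}, a₀, …, a_{α-2}, b_{β-1}, b₀, …, b_{β-2})`. -/
def shift (v : Word α β) : Word α β :=
  (fun i => v.1 ((finRotate α).symm i), fun j => v.2 ((finRotate β).symm j))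

/-- A `ℤ₂ℤ₂[u]`-cyclic code: an `R`-submodule closed under the shift. -/
def IsCyclic (C : Code α β) : Prop := ∀ v ∈ C, shift v ∈ C

/-- `C` is of type `(α, β; k₀, k₁, k₂)`: as an abelian group it is isomorphic to
`ℤ₂^(k₀+k₂) × ℤ₂^(2k₁)`. -/
def HasType (C : Code α β) (k₀ k₁ k₂ : ℕ) : Prop :=
  Nonempty (C ≃+ (Fin (k₀ + k₂) → ZMod 2) × (Fin (2 * k₁) → ZMod 2))

/-- The Lee weight on `R`: `0, 1, u, 1 + u` have weights `0, 1, 2, 1`. -/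
def leeWt (a : R) : ℕ :=
  if a.fst = 0 then (if a.snd = 0 then 0 else 2) else 1

/-- The weight on `ℤ₂^α × R^β`: Hamming weight of the binary part plus Lee weight of the rest. -/
def wt (v : Word α β) : ℕ := hammingNorm v.1 + ∑ j, leeWt (v.2 j)

/-- The minimum distance of a code (meaningful if it has at least two words). -/
noncomputable def minDist (C : Code α β) : ℕ :=
  sInf {d | ∃ v ∈ C, ∃ w ∈ C, v ≠ w ∧ wt (v - w) = d}

/-- The Gray map: `(x, r + uq) ↦ (x, q, r + q)`, of length `α + 2β`. -/
def gray : Word α β →+ (Fin (α + 2 * β) → ZMod 2) where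
  toFun v i := Fin.append v.1
    (Fin.append (fun j => (v.2 j).snd) (fun j => (v.2 j).fst + (v.2 j).snd))
    (Fin.cast (by omega) i)
  map_zero' := by
    funext i
    generalize Fin.cast _ i = k
    refine Fin.addCases (fun k => ?_) (fun k => ?_) k
    · simp only [Fin.append_left, zero_fst, Pi.zero_apply]
    · refine Fin.addCases (fun k => ?_) (fun k => ?_) k <;>
        simp only [Fin.append_left, Fin.append_right, zero_snd, TrivSqZeroExt.fst_zero,
          TrivSqZeroExt.snd_zero, add_zero, Pi.zero_apply]
  map_add' v w := by
    funext i
    simp only [Pi.add_apply]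
    generalize Fin.cast _ i = k
    refine Fin.addCases (fun k => ?_) (fun k => ?_) k
    · simp only [Fin.append_left, add_fst]
    · refine Fin.addCases (fun k => ?_) (fun k => ?_) k
      · simp only [Fin.append_left, Fin.append_right, add_snd, TrivSqZeroExt.snd_add]
      · simp only [Fin.append_right, add_snd, TrivSqZeroExt.fst_add, TrivSqZeroExt.snd_add]
        abel

/-- The Gray image `Φ(C)`, a binary linear code of length `α + 2β`. -/
def grayImage (C : Code α β) : Submodule (ZMod 2) (Fin (α + 2 * β) → ZMod 2) :=
  AddSubgroup.toZModSubmodule 2 (C.toAddSubgroup.map gray)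

end Z2Z2u

/-! ### Stabilizer codes on `n` qubits -/

namespace Quantum

/-- The Hilbert space `(ℂ²)^{⊗ n}` of `n` qubits; the computational basis is indexed by `ℤ₂ⁿ`. -/
abbrev State (n : ℕ) : Type := EuclideanSpace ℂ (Fin n → ZMod 2)

variable {n : ℕ}

/-- The Pauli operator `X(a) Z(b)`, i.e. `|x⟩ ↦ (-1)^{b·x} |x + a⟩`. -/
noncomputable def pauli (a b : Fin n → ZMod 2) : State n →ₗ[ℂ] State n where
  toFun ψ := WithLp.toLp 2 fun y => (-1 : ℂ) ^ (b ⬝ᵥ (y - a)).val * ψ (y - a)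
  map_add' ψ φ := by
    ext y
    simp [mul_add]
  map_smul' c ψ := by
    ext y
    simp [mul_left_comm]

/-- The weight of `X(a) Z(b)`: the number of qubits on which it does not act as a scalar. -/
def pauliWt (a b : Fin n → ZMod 2) : ℕ :=
  (Finset.univ.filter fun i => a i ≠ 0 ∨ b i ≠ 0).card

/-- Abelian subgroups of the Pauli group `{i^c X(a) Z(b)}` that do not contain `-1`. -/
structure IsStabilizerGroup (S : Subgroup (Module.End ℂ (State n))ˣ) : Prop where
  pauli : ∀ g ∈ S, ∃ (c : ℕ) (a b : Fin n → ZMod 2),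
    (g : Module.End ℂ (State n)) = Complex.I ^ c • pauli a b
  comm : ∀ g ∈ S, ∀ h ∈ S, g * h = h * g
  neg_one : (-1 : (Module.End ℂ (State n))ˣ) ∉ S

/-- The joint `+1`-eigenspace of `S`. -/
def fixedSpace (S : Subgroup (Module.End ℂ (State n))ˣ) : Submodule ℂ (State n) :=
  ⨅ g ∈ S, LinearMap.eqLocus (g : Module.End ℂ (State n)) LinearMap.id

/-- Stabilizer codes. -/
def IsStabilizerCode (Q : Submodule ℂ (State n)) : Prop :=
  ∃ S : Subgroup (Module.End ℂ (State n))ˣ, IsStabilizerGroup S ∧ Q = fixedSpace S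

/-- `Q` detects the error `E`: `⟨φ|E|ψ⟩ = c ⟨φ|ψ⟩` on `Q`, with a constant `c` depending on `E`. -/
def Detects (Q : Submodule ℂ (State n)) (E : State n →ₗ[ℂ] State n) : Prop :=
  ∃ c : ℂ, ∀ φ ∈ Q, ∀ ψ ∈ Q, inner ℂ φ (E ψ) = c * inner ℂ φ ψ

/-- `Q` is pure to `t`: Pauli errors of weight `1, …, t - 1` map `Q` into its orthogonal complement.
In particular all errors of weight less than `t` are detected. -/
def IsPureTo (Q : Submodule ℂ (State n)) (t : ℕ) : Prop :=
  ∀ a b : Fin n → ZMod 2, 0 < pauliWt a b → pauliWt a b < t →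
    ∀ φ ∈ Q, ∀ ψ ∈ Q, inner ℂ φ (pauli a b ψ) = 0

/-- `Q` has minimum distance (exactly) `d`: the least weight of a Pauli error that is not detected.
If `Q` is one-dimensional, every error is detected, and by the usual convention `d` is then the
largest number to which `Q` is pure, i.e. the least weight of a nontrivial Pauli error that does not
map `Q` into its orthogonal complement. -/
def HasMinDist (Q : Submodule ℂ (State n)) (d : ℕ) : Prop :=
  if Module.finrank ℂ Q = 1 then
    IsLeast {w | ∃ a b : Fin n → ZMod 2, 0 < pauliWt a b ∧ pauliWt a b = w ∧
      ∃ φ ∈ Q, ∃ ψ ∈ Q, inner ℂ φ (pauli a b ψ) ≠ 0} d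
  else
    IsLeast {w | ∃ a b : Fin n → ZMod 2, pauliWt a b = w ∧ ¬ Detects Q (pauli a b)} d

/-- `Q` is an `[[n, k, d]]` stabilizer code. -/
structure IsStabilizerCodeWith (Q : Submodule ℂ (State n)) (k d : ℕ) : Prop where
  stabilizer : IsStabilizerCode Q
  dim : Module.finrank ℂ Q = 2 ^ k
  dist : HasMinDist Q d

open Classical in
/-- The (unnormalized) coset state `∑_{y ∈ C} |x + y⟩`. -/
noncomputable def cosetState (C : Submodule (ZMod 2) (Fin n → ZMod 2)) (x : Fin n → ZMod 2) :
    State n :=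
  WithLp.toLp 2 fun z => if z - x ∈ C then 1 else 0

/-- The Calderbank-Shor-Steane code of binary linear codes `C₂ ⊆ C₁`: the span of the coset states
`∑_{y ∈ C₂} |x + y⟩`, `x ∈ C₁`. -/
noncomputable def cssCode (C₁ C₂ : Submodule (ZMod 2) (Fin n → ZMod 2)) : Submodule ℂ (State n) :=
  Submodule.span ℂ (cosetState C₂ '' (C₁ : Set (Fin n → ZMod 2)))

end Quantum

/-! The problem reduces to binary codes. The dot product of two Gray images is the sum of the two
coordinates of the `R`-valued product, and closure of `C` under multiplication by `u` makes both
coordinates vanish separately. Hence `Φ(C^⊥) = Φ(C)^⊥` (`grayImage_dual`). Since `Φ` is an additive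
bijection that preserves weights, `D = Φ(C)` is a self-orthogonal binary code of dimension `K` whose
dual has minimum distance `d^⊥`.

For `A ≤ B` the CSS code of `(B, A)` is the fixed space of the operators `X(a) Z(b)` with `a ∈ A`,
`b ∈ B^⊥`. A Pauli operator has a nonzero matrix element on it iff `a ∈ B` and `b ∈ A^⊥`, and is
undetected iff moreover it is not one of these stabilizers (`not_detects_cssCode_iff`). For `A = D`,
`B = D^⊥`, both `a` and `b` then lie in `D^⊥`, which gives purity to `d^⊥` and distance at least
`d^⊥` when `k > 0`.

That distance can exceed `d^⊥`, because the shortest words of `D^⊥` may lie in `D`. A code of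
distance exactly `d^⊥` comes from a discrete intermediate value argument
(`exists_isLeast_isLogical`): CNOT operations lower the distance by at most one at a time, while
each shortens a fixed logical operator, so the value `d^⊥` is reached. -/

/-! ### Orthogonal complements of binary codes -/

namespace Quantum

variable {n : ℕ}

/-- The standard bilinear form on `ℤ₂ⁿ`. -/
def dotForm (n : ℕ) : LinearMap.BilinForm (ZMod 2) (Fin n → ZMod 2) :=
  dotProductBilin (ZMod 2) (ZMod 2)

theorem dotForm_isRefl : (dotForm n).IsRefl := fun a b h =>
  (dotProduct_comm b a).trans h

theorem dotForm_nondegenerate : (dotForm n).Nondegenerate :=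
  (LinearMap.IsRefl.nondegenerate_iff_separatingLeft dotForm_isRefl).2 fun a h =>
    dotProduct_eq_zero a h

/-- The dual of a binary linear code. -/
def perp (A : Submodule (ZMod 2) (Fin n → ZMod 2)) : Submodule (ZMod 2) (Fin n → ZMod 2) :=
  (dotForm n).orthogonal A

theorem mem_perp {A : Submodule (ZMod 2) (Fin n → ZMod 2)} {b : Fin n → ZMod 2} :
    b ∈ perp A ↔ ∀ a ∈ A, b ⬝ᵥ a = 0 := by
  simp only [dotProduct_comm b]
  exact Iff.rfl

theorem perp_perp (A : Submodule (ZMod 2) (Fin n → ZMod 2)) : perp (perp A) = A :=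
  LinearMap.BilinForm.orthogonal_orthogonal dotForm_nondegenerate dotForm_isRefl A

theorem finrank_perp (A : Submodule (ZMod 2) (Fin n → ZMod 2)) :
    Module.finrank (ZMod 2) (perp A) = n - Module.finrank (ZMod 2) A := by
  rw [perp, LinearMap.BilinForm.finrank_orthogonal dotForm_nondegenerate A, Module.finrank_fin_fun]

/-! ### Pauli operators -/

/-- The sign `(-1)^x`. -/
noncomputable def sign (x : ZMod 2) : ℂ := (-1) ^ x.val

theorem sign_zero : sign 0 = 1 := by simp [sign]

theorem sign_add (x y : ZMod 2) : sign (x + y) = sign x * sign y := by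
  rw [sign, ZMod.val_add, ← neg_one_pow_eq_pow_mod_two, pow_add, sign, sign]

theorem sign_of_ne_zero {x : ZMod 2} (hx : x ≠ 0) : sign x = -1 := by
  fin_cases x
  · exact absurd rfl hx
  · simp [sign, ZMod.val]

theorem pauli_apply (a b : Fin n → ZMod 2) (ψ : State n) (y : Fin n → ZMod 2) :
    pauli a b ψ y = sign (b ⬝ᵥ (y - a)) * ψ (y - a) := rfl

theorem pauli_zero_zero : pauli (0 : Fin n → ZMod 2) 0 = 1 := by
  ext ψ y
  simp [pauli_apply, sign_zero]

/-- Moving `Z(b)` past `X(a')` costs the sign `(-1)^{b·a'}`, which is trivial here. -/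
theorem pauli_mul_pauli {a a' b b' : Fin n → ZMod 2} (h : b ⬝ᵥ a' = 0) :
    pauli a b * pauli a' b' = pauli (a + a') (b + b') := by
  ext ψ y
  have h1 : b ⬝ᵥ (y - a) = b ⬝ᵥ (y - (a + a')) := by
    rw [← sub_sub, dotProduct_sub b (y - a), h, sub_zero]
  rw [Module.End.mul_apply]
  simp only [pauli_apply]
  rw [add_dotProduct, sign_add, h1, sub_sub, mul_assoc]

/-! ### Coset states and CSS codes -/

variable {A B : Submodule (ZMod 2) (Fin n → ZMod 2)}

open Classical in
theorem cosetState_apply (x z : Fin n → ZMod 2) :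
    cosetState A x z = if z - x ∈ A then 1 else 0 := rfl

theorem cosetState_congr {x y : Fin n → ZMod 2} (h : x - y ∈ A) :
    cosetState A x = cosetState A y := by
  ext z
  have : z - x ∈ A ↔ z - y ∈ A := by
    rw [show z - y = (z - x) + (x - y) by abel]
    exact (A.add_mem_iff_left h).symm
  rw [cosetState_apply, cosetState_apply]
  classical exact if_congr this rfl rfl

theorem cosetState_ne_zero (x : Fin n → ZMod 2) : cosetState A x ≠ 0 := fun h => by
  have := congrArg (fun ψ : State n => ψ x) h
  simp [cosetState_apply] at this

theorem inner_cosetState {x y : Fin n → ZMod 2} (h : x - y ∉ A) :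
    inner ℂ (cosetState A x) (cosetState A y) = 0 := by
  rw [PiLp.inner_apply]
  refine Finset.sum_eq_zero fun z _ => ?_
  by_cases hx : z - x ∈ A
  · have hy : z - y ∉ A := fun hy => h (by simpa using A.sub_mem hy hx)
    simp [cosetState_apply, hy]
  · simp [cosetState_apply, hx]

theorem inner_cosetState_self_ne_zero (x : Fin n → ZMod 2) :
    inner ℂ (cosetState A x) (cosetState A x) ≠ 0 :=
  inner_self_ne_zero.2 (cosetState_ne_zero x)

theorem pauli_cosetState {b : Fin n → ZMod 2} (hb : b ∈ perp A) (a x : Fin n → ZMod 2) :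
    pauli a b (cosetState A x) = sign (b ⬝ᵥ x) • cosetState A (x + a) := by
  ext y
  rw [pauli_apply, PiLp.smul_apply, cosetState_apply, cosetState_apply, smul_eq_mul,
    show y - (x + a) = y - a - x by abel]
  split_ifs with h
  · have := mem_perp.1 hb _ h
    rw [dotProduct_sub, sub_eq_zero] at this
    rw [this]
  · simp

theorem cosetState_mem_cssCode {x : Fin n → ZMod 2} (hx : x ∈ B) :
    cosetState A x ∈ cssCode B A :=
  Submodule.subset_span ⟨x, hx, rfl⟩

/-- The states in the CSS code are those supported on `B` and constant on the cosets of `A`. -/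
theorem mem_cssCode (hAB : A ≤ B) {ψ : State n} :
    ψ ∈ cssCode B A ↔ (∀ y, y ∉ B → ψ y = 0) ∧ ∀ a ∈ A, ∀ y, ψ (y - a) = ψ y := by
  classical
  constructor
  · intro h
    refine Submodule.span_induction ?_ ⟨fun _ _ => rfl, fun _ _ _ => rfl⟩ ?_ ?_ h
    · rintro _ ⟨x, hx, rfl⟩
      refine ⟨fun y hy => ?_, fun a ha y => ?_⟩
      · have : y - x ∉ A := fun h => hy (by simpa using B.add_mem (hAB h) hx)
        simp [cosetState_apply, this]
      · have : y - a - x ∈ A ↔ y - x ∈ A := by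
          rw [sub_right_comm]
          exact A.sub_mem_iff_left ha
        simp only [cosetState_apply, this]
    · rintro φ ψ _ _ ⟨h1, h2⟩ ⟨h3, h4⟩
      exact ⟨fun y hy => by simp [h1 y hy, h3 y hy], fun a ha y => by simp [h2 a ha, h4 a ha]⟩
    · rintro c ψ _ ⟨h1, h2⟩
      exact ⟨fun y hy => by simp [h1 y hy], fun a ha y => by simp [h2 a ha]⟩
  · rintro ⟨h1, h2⟩
    -- Summing over all of `B` instead of over coset representatives counts each coset `|A|` times;
    -- no representatives need be chosen.
    have key : ∑ x ∈ Finset.univ.filter (· ∈ B), ψ x • cosetState A x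
        = (Fintype.card A : ℂ) • ψ := by
      ext z
      have hsum : ∀ x, x ∈ Finset.univ.filter (· ∈ B) →
          (ψ x • cosetState A x) z = if z - x ∈ A then ψ z else 0 := by
        intro x _
        rw [PiLp.smul_apply, cosetState_apply, smul_eq_mul]
        split_ifs with h
        · rw [mul_one, ← h2 _ h z, sub_sub_cancel]
        · rw [mul_zero]
      rw [WithLp.ofLp_sum, Finset.sum_apply, Finset.sum_congr rfl hsum, PiLp.smul_apply,
        smul_eq_mul]
      by_cases hz : z ∈ B
      · rw [← Finset.sum_filter, Finset.sum_const, nsmul_eq_mul]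
        congr 2
        rw [← Fintype.card_coe]
        refine Fintype.card_congr
          { toFun := fun x => ⟨z - x, (Finset.mem_filter.1 x.2).2⟩
            invFun := fun a => ⟨z - a, ?_⟩
            left_inv := fun x => by simp
            right_inv := fun a => by simp }
        simp [B.sub_mem hz (hAB a.2)]
      · rw [h1 z hz]
        simp
    have hc : (Fintype.card A : ℂ) ≠ 0 := Nat.cast_ne_zero.2 Fintype.card_ne_zero
    rw [← Submodule.smul_mem_iff _ hc, ← key]
    exact Submodule.sum_mem _ fun x hx => Submodule.smul_mem _ _
      (cosetState_mem_cssCode (Finset.mem_filter.1 hx).2)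

theorem pauli_eq_self_of_mem (hAB : A ≤ B) {a b : Fin n → ZMod 2} (ha : a ∈ A) (hb : b ∈ perp B)
    {ψ : State n} (hψ : ψ ∈ cssCode B A) : pauli a b ψ = ψ := by
  obtain ⟨h1, h2⟩ := (mem_cssCode hAB).1 hψ
  ext y
  rw [pauli_apply, h2 a ha]
  by_cases hy : y ∈ B
  · rw [mem_perp.1 hb _ (B.sub_mem hy (hAB ha)), sign_zero, one_mul]
  · rw [h1 y hy, mul_zero]

/-- A Pauli operator either is an element of `X(B) Z(A^⊥)` or maps the CSS code into its
orthogonal complement. -/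
theorem exists_inner_pauli_ne_zero_iff (hAB : A ≤ B) {a b : Fin n → ZMod 2} :
    (∃ φ ∈ cssCode B A, ∃ ψ ∈ cssCode B A, inner ℂ φ (pauli a b ψ) ≠ 0) ↔
      a ∈ B ∧ b ∈ perp A := by
  constructor
  · rintro ⟨φ, hφ, ψ, hψ, hne⟩
    obtain ⟨h1, h2⟩ := (mem_cssCode hAB).1 hφ
    obtain ⟨h3, h4⟩ := (mem_cssCode hAB).1 hψ
    rw [PiLp.inner_apply] at hne
    constructor
    -- The supports of `φ` and of the image of `ψ` lie in the disjoint cosets `B` and `a + B`.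
    · by_contra ha
      refine hne (Finset.sum_eq_zero fun y _ => ?_)
      by_cases hy : y ∈ B
      · have : y - a ∉ B := fun h => ha (by simpa using B.sub_mem hy h)
        rw [pauli_apply, h3 _ this, mul_zero, inner_zero_right]
      · rw [h1 y hy, inner_zero_left]
    · refine mem_perp.2 fun a₀ ha₀ => ?_
      -- Translating the summation variable by `a₀` flips the sign of every term, so the inner
      -- product equals its own negative.
      by_contra hb
      have hb' : b ⬝ᵥ (-a₀) ≠ 0 := by simpa using hb
      have h := Equiv.sum_comp (Equiv.subRight a₀) fun y => inner ℂ (φ y) (pauli a b ψ y)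
      have hneg : ∀ y, inner ℂ (φ (y - a₀)) (pauli a b ψ (y - a₀)) =
          -inner ℂ (φ y) (pauli a b ψ y) := by
        intro y
        rw [h2 a₀ ha₀, pauli_apply, pauli_apply, sub_right_comm, h4 a₀ ha₀,
          sub_eq_add_neg (y - a), dotProduct_add, sign_add, sign_of_ne_zero hb']
        rw [mul_neg_one, neg_mul, inner_neg_right]
      simp only [Equiv.subRight_apply, hneg, Finset.sum_neg_distrib] at h
      exact hne (self_eq_neg.1 h.symm)
  · rintro ⟨ha, hb⟩
    refine ⟨_, cosetState_mem_cssCode ha, _, cosetState_mem_cssCode B.zero_mem, ?_⟩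
    rw [pauli_cosetState hb, dotProduct_zero, sign_zero, one_smul, zero_add]
    exact inner_cosetState_self_ne_zero a

/-- The pairs `(a, b)` for which `X(a) Z(b)` is a nontrivial logical operator of the CSS code. -/
def IsLogical (A B : Submodule (ZMod 2) (Fin n → ZMod 2)) (a b : Fin n → ZMod 2) : Prop :=
  a ∈ B ∧ b ∈ perp A ∧ ¬(a ∈ A ∧ b ∈ perp B)

theorem not_detects_cssCode_iff (hAB : A ≤ B) {a b : Fin n → ZMod 2} :
    ¬Detects (cssCode B A) (pauli a b) ↔ IsLogical A B a b := by
  constructor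
  · intro h
    obtain ⟨ha, hb⟩ : a ∈ B ∧ b ∈ perp A := by
      rw [← exists_inner_pauli_ne_zero_iff hAB]
      by_contra! h'
      exact h ⟨0, fun φ hφ ψ hψ => by rw [h' φ hφ ψ hψ, zero_mul]⟩
    refine ⟨ha, hb, fun h' => h ⟨1, fun φ _ ψ hψ => ?_⟩⟩
    rw [pauli_eq_self_of_mem hAB h'.1 h'.2 hψ, one_mul]
  · rintro ⟨ha, hb, hab⟩ ⟨c, hc⟩
    have h0 := cosetState_mem_cssCode (A := A) B.zero_mem
    -- If `a ∈ A`, the operator acts on coset states by signs, and the cosets of `0` and `x` force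
    -- both `c = 1` and `c = -1`. If `a ∉ A`, it moves the coset state of `0` to the orthogonal
    -- coset state of `a`.
    by_cases haA : a ∈ A
    · obtain ⟨x, hx, hbx⟩ : ∃ x ∈ B, b ⬝ᵥ x ≠ 0 := by
        by_contra! h
        exact hab ⟨haA, mem_perp.2 h⟩
      have hshift : ∀ y, cosetState A (y + a) = cosetState A y := fun y =>
        cosetState_congr (by simpa using haA)
      have h1 := hc _ h0 _ h0
      have h2 := hc _ (cosetState_mem_cssCode hx) _ (cosetState_mem_cssCode hx)
      rw [pauli_cosetState hb, hshift, inner_smul_right] at h1 h2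
      have h1' := mul_right_cancel₀ (inner_cosetState_self_ne_zero 0) h1
      have h2' := mul_right_cancel₀ (inner_cosetState_self_ne_zero x) h2
      rw [dotProduct_zero, sign_zero] at h1'
      rw [sign_of_ne_zero hbx, ← h1'] at h2'
      norm_num at h2'
    · have h1 := hc _ (cosetState_mem_cssCode ha) _ h0
      rw [pauli_cosetState hb, inner_cosetState (by simpa using haA), mul_zero, dotProduct_zero,
        sign_zero, one_smul, zero_add] at h1
      exact inner_cosetState_self_ne_zero a h1

/-- The operators `X(a) Z(b)` with `a ∈ A`, `b ∈ B^⊥`, as a homomorphism. -/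
noncomputable def cssStabilizerHom (hAB : A ≤ B) :
    Multiplicative (A × perp B) →* Module.End ℂ (State n) where
  toFun p := pauli p.toAdd.1 p.toAdd.2
  map_one' := pauli_zero_zero
  map_mul' p q := (pauli_mul_pauli (mem_perp.1 p.toAdd.2.2 _ (hAB q.toAdd.1.2))).symm

theorem isStabilizerCode_cssCode (hAB : A ≤ B) : IsStabilizerCode (cssCode B A) := by
  refine ⟨(cssStabilizerHom hAB).toHomUnits.range, ⟨?_, ?_, ?_⟩, ?_⟩
  · rintro _ ⟨p, rfl⟩
    exact ⟨0, p.toAdd.1, p.toAdd.2, by simp [cssStabilizerHom]⟩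
  · rintro _ ⟨p, rfl⟩ _ ⟨q, rfl⟩
    rw [← map_mul, ← map_mul, mul_comm]
  · rintro ⟨p, hp⟩
    have h1 : pauli p.toAdd.1 p.toAdd.2 = (-1 : Module.End ℂ (State n)) :=
      congrArg Units.val hp
    have h0 := cosetState_mem_cssCode (A := A) B.zero_mem
    have h2 := pauli_eq_self_of_mem hAB p.toAdd.1.2 p.toAdd.2.2 h0
    rw [h1, LinearMap.neg_apply, Module.End.one_apply] at h2
    have h3 := congrArg (fun φ : State n => φ 0) h2
    simp only [PiLp.neg_apply, cosetState_apply, sub_zero, A.zero_mem, if_true] at h3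
    norm_num at h3
  · ext ψ
    simp only [fixedSpace, Submodule.mem_iInf, LinearMap.mem_eqLocus, LinearMap.id_apply]
    constructor
    · rintro hψ _ ⟨p, rfl⟩
      exact pauli_eq_self_of_mem hAB p.toAdd.1.2 p.toAdd.2.2 hψ
    · intro h
      have h' : ∀ a ∈ A, ∀ b ∈ perp B, pauli a b ψ = ψ := fun a ha b hb =>
        h _ ⟨Multiplicative.ofAdd (⟨a, ha⟩, ⟨b, hb⟩), rfl⟩
      refine (mem_cssCode hAB).2 ⟨fun y hy => ?_, fun a ha y => ?_⟩
      -- Outside `B = B^⊥⊥` some `Z(b)` with `b ∈ B^⊥` flips the sign of `ψ y`.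
      · rw [← perp_perp B, mem_perp] at hy
        push Not at hy
        obtain ⟨b, hb, hby⟩ := hy
        have := congrArg (fun φ : State n => φ y) (h' 0 A.zero_mem b hb)
        simp only [pauli_apply, sub_zero] at this
        rw [dotProduct_comm] at hby
        rw [sign_of_ne_zero hby, neg_one_mul] at this
        exact self_eq_neg.1 this.symm
      · have := congrArg (fun φ : State n => φ y) (h' a ha 0 (Submodule.zero_mem _))
        simpa [pauli_apply, sign_zero] using this

/-- Distinct cosets of `A` give coset states with disjoint supports, so one state for each element
of `B / A` yields an orthogonal basis. -/
theorem finrank_cssCode (hAB : A ≤ B) :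
    Module.finrank ℂ (cssCode B A) =
      2 ^ (Module.finrank (ZMod 2) B - Module.finrank (ZMod 2) A) := by
  classical
  let A' : Submodule (ZMod 2) B := A.submoduleOf B
  let v : B ⧸ A' → State n := fun q => cosetState A (q.out : B)
  have hout : ∀ x : B, ((A'.mkQ x).out : B).1 - x.1 ∈ A := fun x => by
    have : A'.mkQ (A'.mkQ x).out = A'.mkQ x := Quotient.out_eq' _
    exact (Submodule.Quotient.eq A').1 this
  have hli : LinearIndependent ℂ v := by
    refine linearIndependent_of_ne_zero_of_inner_eq_zero (fun q => cosetState_ne_zero _) ?_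
    intro p q hpq
    refine inner_cosetState fun h => hpq ?_
    have : A'.mkQ p.out = A'.mkQ q.out := (Submodule.Quotient.eq A').2 h
    have hp : A'.mkQ p.out = p := Quotient.out_eq' _
    have hq : A'.mkQ q.out = q := Quotient.out_eq' _
    rw [← hp, this, hq]
  have hspan : cssCode B A = Submodule.span ℂ (Set.range v) := by
    refine congrArg _ (Set.Subset.antisymm ?_ ?_)
    · rintro _ ⟨x, hx, rfl⟩
      exact ⟨A'.mkQ ⟨x, hx⟩, cosetState_congr (hout ⟨x, hx⟩)⟩
    · rintro _ ⟨q, rfl⟩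
      exact ⟨_, q.out.2, rfl⟩
  have : Fintype (B ⧸ A') := Fintype.ofFinite _
  rw [hspan, finrank_span_eq_card hli, Module.card_eq_pow_finrank (K := ZMod 2), ZMod.card,
    Submodule.finrank_quotient, (Submodule.submoduleOfEquivOfLe hAB).finrank_eq]

end Quantum

/-! ### Prescribing the distance of a CSS code by elementary row operations -/

namespace Quantum

variable {n : ℕ} {A B : Submodule (ZMod 2) (Fin n → ZMod 2)}

/-- The elementary operation `xᵢ ↦ xᵢ + xⱼ` as a linear map. -/
def addCoordHom (i j : Fin n) : (Fin n → ZMod 2) →ₗ[ZMod 2] (Fin n → ZMod 2) :=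
  LinearMap.id + LinearMap.single (ZMod 2) (fun _ => ZMod 2) i ∘ₗ LinearMap.proj j

theorem addCoordHom_apply (i j : Fin n) (x : Fin n → ZMod 2) :
    addCoordHom i j x = x + Pi.single i (x j) := rfl

theorem addCoordHom_same (i j : Fin n) (x : Fin n → ZMod 2) :
    addCoordHom i j x i = x i + x j := by
  simp [addCoordHom_apply]

theorem addCoordHom_of_ne {i j k : Fin n} (h : k ≠ i) (x : Fin n → ZMod 2) :
    addCoordHom i j x k = x k := by
  simp [addCoordHom_apply, h]

theorem addCoordHom_involutive {i j : Fin n} (h : i ≠ j) :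
    Function.Involutive (addCoordHom i j) := fun x => by
  ext k
  by_cases hk : k = i
  · subst hk
    rw [addCoordHom_same, addCoordHom_same, addCoordHom_of_ne h.symm, add_assoc,
      CharTwo.add_self_eq_zero, add_zero]
  · rw [addCoordHom_of_ne hk, addCoordHom_of_ne hk]

/-- The elementary operation `xᵢ ↦ xᵢ + xⱼ`, `i ≠ j`. -/
def addCoord {i j : Fin n} (h : i ≠ j) : (Fin n → ZMod 2) ≃ₗ[ZMod 2] (Fin n → ZMod 2) :=
  LinearEquiv.ofInvolutive (addCoordHom i j) (addCoordHom_involutive h)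

theorem mem_map_addCoord {i j : Fin n} (h : i ≠ j) {x : Fin n → ZMod 2} :
    x ∈ A.map (addCoord h : (Fin n → ZMod 2) →ₗ[ZMod 2] (Fin n → ZMod 2)) ↔
      addCoordHom i j x ∈ A :=
  Submodule.mem_map_equiv A (e := addCoord h)

theorem addCoordHom_dotProduct (i j : Fin n) (x y : Fin n → ZMod 2) :
    x ⬝ᵥ addCoordHom i j y = addCoordHom j i x ⬝ᵥ y := by
  rw [addCoordHom_apply, addCoordHom_apply, dotProduct_add, add_dotProduct, dotProduct_single,
    single_dotProduct]

/-- The dual transforms by the transpose, which exchanges `i` and `j`. This is how a CNOT gate acts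
on the `X`- and `Z`-parts of a Pauli operator. -/
theorem mem_perp_map_addCoord {i j : Fin n} (h : i ≠ j) {b : Fin n → ZMod 2} :
    b ∈ perp (A.map (addCoord h : (Fin n → ZMod 2) →ₗ[ZMod 2] (Fin n → ZMod 2))) ↔
      addCoordHom j i b ∈ perp A := by
  simp only [mem_perp, Submodule.mem_map, forall_exists_index, and_imp,
    forall_apply_eq_imp_iff₂, ← addCoordHom_dotProduct]
  exact Iff.rfl

theorem isLogical_map_addCoord {i j : Fin n} (h : i ≠ j) {a b : Fin n → ZMod 2} :
    IsLogical (A.map (addCoord h : (Fin n → ZMod 2) →ₗ[ZMod 2] (Fin n → ZMod 2)))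
        (B.map (addCoord h : (Fin n → ZMod 2) →ₗ[ZMod 2] (Fin n → ZMod 2))) a b ↔
      IsLogical A B (addCoordHom i j a) (addCoordHom j i b) := by
  simp only [IsLogical, mem_map_addCoord, mem_perp_map_addCoord]

/-- The `X`-part changes only at `i` and the `Z`-part only at `j`. If `i` is already in the support,
only `j` can be new. -/
theorem pauliWt_addCoordHom_le (i j : Fin n) (a b : Fin n → ZMod 2) :
    pauliWt (addCoordHom i j a) (addCoordHom j i b) ≤ pauliWt a b + 1 := by
  have hk : ∀ k, k ≠ i → k ≠ j → addCoordHom i j a k = a k ∧ addCoordHom j i b k = b k :=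
    fun k hi hj => ⟨addCoordHom_of_ne hi a, addCoordHom_of_ne hj b⟩
  by_cases hi : a i ≠ 0 ∨ b i ≠ 0
  · refine (Finset.card_le_card ?_).trans (Finset.card_insert_le j _)
    intro k hk'
    simp only [Finset.mem_filter, Finset.mem_univ, true_and, Finset.mem_insert] at hk' ⊢
    by_cases hkj : k = j
    · exact Or.inl hkj
    · by_cases hki : k = i
      · exact Or.inr (hki ▸ hi)
      · rw [(hk k hki hkj).1, (hk k hki hkj).2] at hk'
        exact Or.inr hk'
  -- Now `b i = 0`, so nothing is added at `j`, and only `i` can be new.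
  · push Not at hi
    refine (Finset.card_le_card ?_).trans (Finset.card_insert_le i _)
    intro k hk'
    simp only [Finset.mem_filter, Finset.mem_univ, true_and, Finset.mem_insert] at hk' ⊢
    by_cases hki : k = i
    · exact Or.inl hki
    · rw [addCoordHom_of_ne hki] at hk'
      by_cases hkj : k = j
      · subst hkj
        rw [addCoordHom_same, hi.2, add_zero] at hk'
        exact Or.inr hk'
      · rw [addCoordHom_of_ne hkj] at hk'
        exact Or.inr hk'

theorem pauliWt_zero_right (a : Fin n → ZMod 2) : pauliWt a 0 = hammingNorm a := by
  simp [pauliWt, hammingNorm]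

theorem hammingNorm_le_pauliWt_left (a b : Fin n → ZMod 2) : hammingNorm a ≤ pauliWt a b :=
  Finset.card_le_card (Finset.monotone_filter_right _ fun _ _ h => Or.inl h)

theorem hammingNorm_le_pauliWt_right (a b : Fin n → ZMod 2) : hammingNorm b ≤ pauliWt a b :=
  Finset.card_le_card (Finset.monotone_filter_right _ fun _ _ h => Or.inr h)

/-- Two nonzero entries over `ℤ₂` cancel when added. -/
theorem exists_addCoordHom_hammingNorm {x : Fin n → ZMod 2} (hx : 1 < hammingNorm x) :
    ∃ i j, i ≠ j ∧ hammingNorm (addCoordHom i j x) < hammingNorm x := by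
  obtain ⟨i, hi, j, hj, hij⟩ := Finset.one_lt_card.1 hx
  simp only [Finset.mem_filter, Finset.mem_univ, true_and] at hi hj
  refine ⟨i, j, hij, Finset.card_lt_card (Finset.ssubset_iff_of_subset ?_ |>.2 ⟨i, ?_, ?_⟩)⟩
  · intro k hk
    simp only [Finset.mem_filter, Finset.mem_univ, true_and] at hk ⊢
    by_cases hki : k = i
    · exact hki ▸ hi
    · rwa [addCoordHom_of_ne hki] at hk
  · simpa using hi
  · have : ∀ s t : ZMod 2, s ≠ 0 → t ≠ 0 → s + t = 0 := by decide
    simp [addCoordHom_same, this _ _ hi hj]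

/-- Every number between `1` and the distance of a CSS code with a nontrivial logical operator is
the distance of a CSS code with the same parameters. -/
theorem exists_isLeast_isLogical {t : ℕ} (ht : 0 < t) (w : ℕ) :
    ∀ A B : Submodule (ZMod 2) (Fin n → ZMod 2), A ≤ B →
      (∀ a b, IsLogical A B a b → t ≤ pauliWt a b) → (∃ x ∈ B, x ∉ A ∧ hammingNorm x ≤ w) →
      ∃ A' B' : Submodule (ZMod 2) (Fin n → ZMod 2), A' ≤ B' ∧
        Module.finrank (ZMod 2) A' = Module.finrank (ZMod 2) A ∧
        Module.finrank (ZMod 2) B' = Module.finrank (ZMod 2) B ∧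
        IsLeast {s | ∃ a b, pauliWt a b = s ∧ IsLogical A' B' a b} t := by
  induction w with
  | zero =>
    rintro A B - - ⟨x, -, hxA, hx⟩
    rw [Nat.le_zero, hammingNorm_eq_zero] at hx
    exact absurd (hx ▸ A.zero_mem) hxA
  | succ w ih =>
    rintro A B hAB hle ⟨x, hxB, hxA, hx⟩
    by_cases hex : ∃ a b, pauliWt a b = t ∧ IsLogical A B a b
    · refine ⟨A, B, hAB, rfl, rfl, hex, ?_⟩
      rintro _ ⟨a, b, rfl, hab⟩
      exact hle a b hab
    -- As `t` is not attained, all logical weights exceed it, which leaves room for a loss of one.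
    -- Also `X(x)` is logical, so `x` has weight above `t ≥ 1` and can be shortened.
    · have hlt : ∀ a b, IsLogical A B a b → t < pauliWt a b := fun a b hab =>
        (hle a b hab).lt_of_ne fun h => hex ⟨a, b, h.symm, hab⟩
      have hxt := hlt x 0 ⟨hxB, Submodule.zero_mem _, fun h => hxA h.1⟩
      rw [pauliWt_zero_right] at hxt
      obtain ⟨i, j, hij, hlt'⟩ := exists_addCoordHom_hammingNorm (x := x) (by omega)
      obtain ⟨A', B', h1, h2, h3, h4⟩ := ih _ _ (Submodule.map_mono hAB)
        (fun a b hab => by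
          have h1 := hlt _ _ ((isLogical_map_addCoord hij).1 hab)
          have h2 := pauliWt_addCoordHom_le i j a b
          omega)
        ⟨addCoordHom i j x,
          (mem_map_addCoord hij).2 (by rwa [addCoordHom_involutive hij]),
          fun h => hxA (by rwa [mem_map_addCoord hij, addCoordHom_involutive hij] at h),
          by omega⟩
      exact ⟨A', B', h1, h2.trans (LinearEquiv.finrank_map_eq _ _),
        h3.trans (LinearEquiv.finrank_map_eq _ _), h4⟩

/-! ### CSS codes of self-orthogonal binary codes -/

variable {D : Submodule (ZMod 2) (Fin n → ZMod 2)} {t : ℕ}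

theorem hasMinDist_cssCode_of_isLeast (hAB : A ≤ B) (h : Module.finrank ℂ (cssCode B A) ≠ 1)
    (ht : IsLeast {s | ∃ a b, pauliWt a b = s ∧ IsLogical A B a b} t) :
    HasMinDist (cssCode B A) t := by
  rw [HasMinDist, if_neg h]
  simpa only [not_detects_cssCode_iff hAB] using ht

/-- A nonzero matrix element puts both `a` and `b` in `D^⊥`, so weight below `t` forces both to
vanish. -/
theorem isPureTo_cssCode_perp (hD : D ≤ perp D) (ht : ∀ v ∈ perp D, v ≠ 0 → t ≤ hammingNorm v) :
    IsPureTo (cssCode (perp D) D) t := by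
  intro a b hpos hlt φ hφ ψ hψ
  by_contra hne
  obtain ⟨ha, hb⟩ := (exists_inner_pauli_ne_zero_iff hD).1 ⟨φ, hφ, ψ, hψ, hne⟩
  have ha0 : a = 0 := by
    by_contra h
    exact absurd ((ht a ha h).trans (hammingNorm_le_pauliWt_left a b)) hlt.not_ge
  have hb0 : b = 0 := by
    by_contra h
    exact absurd ((ht b hb h).trans (hammingNorm_le_pauliWt_right a b)) hlt.not_ge
  simp [ha0, hb0, pauliWt] at hpos

theorem le_pauliWt_of_isLogical (ht : ∀ v ∈ perp D, v ≠ 0 → t ≤ hammingNorm v)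
    {a b : Fin n → ZMod 2} (h : IsLogical D (perp D) a b) : t ≤ pauliWt a b := by
  by_cases ha : a = 0
  · by_cases hb : b = 0
    · subst ha hb
      exact absurd ⟨Submodule.zero_mem _, Submodule.zero_mem _⟩ h.2.2
    · exact (ht b h.2.1 hb).trans (hammingNorm_le_pauliWt_right a b)
  · exact (ht a h.1 ha).trans (hammingNorm_le_pauliWt_left a b)

theorem hasMinDist_cssCode_perp_of_finrank_eq_one (hD : D ≤ perp D)
    (h : Module.finrank ℂ (cssCode (perp D) D) = 1)
    (ht : IsLeast {s | ∃ v ∈ perp D, v ≠ 0 ∧ hammingNorm v = s} t) :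
    HasMinDist (cssCode (perp D) D) t := by
  rw [HasMinDist, if_pos h]
  constructor
  · obtain ⟨v, hv, hv0, rfl⟩ := ht.1
    exact ⟨v, 0, by rwa [pauliWt_zero_right, hammingNorm_pos_iff], pauliWt_zero_right v,
      (exists_inner_pauli_ne_zero_iff hD).2 ⟨hv, Submodule.zero_mem _⟩⟩
  · rintro _ ⟨a, b, hpos, rfl, φ, hφ, ψ, hψ, hne⟩
    by_contra hlt
    exact hne (isPureTo_cssCode_perp hD (fun v hv hv0 => ht.2 ⟨v, hv, hv0, rfl⟩) a b hpos
      (not_le.1 hlt) φ hφ ψ hψ)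

/-- A self-orthogonal binary code `D` gives a stabilizer code whose distance is that of the dual
code, and a CSS code whose distance is at least this. -/
theorem exists_isStabilizerCodeWith_of_le_perp (hD : D ≤ perp D)
    (ht : IsLeast {s | ∃ v ∈ perp D, v ≠ 0 ∧ hammingNorm v = s} t) :
    (∃ Q : Submodule ℂ (State n),
      IsStabilizerCodeWith Q (n - 2 * Module.finrank (ZMod 2) D) t) ∧
    ∃ d, t ≤ d ∧
      IsStabilizerCodeWith (cssCode (perp D) D) (n - 2 * Module.finrank (ZMod 2) D) d := by
  have hle : ∀ v ∈ perp D, v ≠ 0 → t ≤ hammingNorm v := fun v hv hv0 => ht.2 ⟨v, hv, hv0, rfl⟩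
  have htpos : 0 < t := by
    obtain ⟨v, -, hv0, rfl⟩ := ht.1
    exact hammingNorm_pos_iff.2 hv0
  have hdim : n - 2 * Module.finrank (ZMod 2) D =
      Module.finrank (ZMod 2) (perp D) - Module.finrank (ZMod 2) D := by
    rw [finrank_perp]
    omega
  rw [hdim]
  have hrank := finrank_cssCode hD
  -- In dimension one the distance is measured by purity, so the CSS code itself has distance
  -- exactly `t`. Otherwise `D ≠ D^⊥`, and a word `x` of the difference starts the descent.
  by_cases h1 : Module.finrank ℂ (cssCode (perp D) D) = 1
  · have h := IsStabilizerCodeWith.mk (isStabilizerCode_cssCode hD) hrank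
      (hasMinDist_cssCode_perp_of_finrank_eq_one hD h1 ht)
    exact ⟨⟨_, h⟩, t, le_rfl, h⟩
  · obtain ⟨x, hx, hxD⟩ : ∃ x ∈ perp D, x ∉ D := by
      by_contra! h
      refine h1 ?_
      rw [hrank, le_antisymm h hD, Nat.sub_self, pow_zero]
    have hlog : ∀ a b, IsLogical D (perp D) a b → t ≤ pauliWt a b :=
      fun a b => le_pauliWt_of_isLogical hle
    constructor
    · obtain ⟨A', B', hAB', hA', hB', hd⟩ :=
        exists_isLeast_isLogical htpos _ D (perp D) hD hlog ⟨x, hx, hxD, le_rfl⟩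
      have hrank' := finrank_cssCode hAB'
      rw [hA', hB'] at hrank'
      exact ⟨_, isStabilizerCode_cssCode hAB', hrank',
        hasMinDist_cssCode_of_isLeast hAB' (hrank' ▸ hrank ▸ h1) hd⟩
    · have hne : {s | ∃ a b, pauliWt a b = s ∧ IsLogical D (perp D) a b}.Nonempty :=
        ⟨_, x, 0, rfl, hx, Submodule.zero_mem _, fun h => hxD h.1⟩
      have hd : IsLeast {s | ∃ a b, pauliWt a b = s ∧ IsLogical D (perp D) a b} _ :=
        ⟨Nat.sInf_mem hne, fun s hs => Nat.sInf_le hs⟩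
      refine ⟨_, ?_, isStabilizerCode_cssCode hD, hrank,
        hasMinDist_cssCode_of_isLeast hD h1 hd⟩
      obtain ⟨a, b, hab, hl⟩ := hd.1
      exact hab ▸ hlog a b hl

end Quantum

/-! ### The Gray map -/

namespace Z2Z2u

variable {α β : ℕ}

theorem gray_apply (v : Word α β) (i : Fin (α + 2 * β)) :
    gray v i = Fin.append v.1
      (Fin.append (fun j => (v.2 j).snd) (fun j => (v.2 j).fst + (v.2 j).snd))
      (finCongr (by omega) i) := rfl

/-- A general `f` serves both the dot product and the Hamming weight. -/
theorem sum_gray₂ {M : Type*} [AddCommMonoid M] (f : ZMod 2 → ZMod 2 → M) (v w : Word α β) :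
    ∑ i, f (gray v i) (gray w i) = ∑ i, f (v.1 i) (w.1 i) +
      (∑ j, f (v.2 j).snd (w.2 j).snd +
        ∑ j, f ((v.2 j).fst + (v.2 j).snd) ((w.2 j).fst + (w.2 j).snd)) := by
  simp only [gray_apply]
  rw [Equiv.sum_comp (finCongr (show α + 2 * β = α + (β + β) by omega)) fun k =>
    f (Fin.append v.1
      (Fin.append (fun j => (v.2 j).snd) (fun j => (v.2 j).fst + (v.2 j).snd)) k)
      (Fin.append w.1
      (Fin.append (fun j => (w.2 j).snd) (fun j => (w.2 j).fst + (w.2 j).snd)) k)]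
  simp only [Fin.sum_univ_add, Fin.append_left, Fin.append_right]

theorem innerProd_fst (v w : Word α β) :
    (innerProd v w).fst = ∑ j, (v.2 j).fst * (w.2 j).fst := by
  simp [innerProd, TrivSqZeroExt.fst_sum]

theorem innerProd_snd (v w : Word α β) :
    (innerProd v w).snd = ∑ i, v.1 i * w.1 i +
      ∑ j, ((v.2 j).fst * (w.2 j).snd + (w.2 j).fst * (v.2 j).snd) := by
  simp [innerProd, TrivSqZeroExt.snd_sum, mul_comm]

/-- In `qq' + (r + q)(r' + q')` the two terms `qq'` cancel in characteristic 2. -/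
theorem gray_dotProduct_gray (v w : Word α β) :
    gray v ⬝ᵥ gray w = (innerProd v w).fst + (innerProd v w).snd := by
  have key : ∀ r q r' q' : ZMod 2,
      q * q' + (r + q) * (r' + q') = r * r' + (r * q' + r' * q) := by decide
  rw [dotProduct, sum_gray₂ (fun x y => x * y), innerProd_fst, innerProd_snd,
    ← Finset.sum_add_distrib, add_left_comm, ← Finset.sum_add_distrib]
  exact congrArg _ (Finset.sum_congr rfl fun j _ => key _ _ _ _)

theorem hammingNorm_gray (v : Word α β) : hammingNorm (gray v) = wt v := by
  have key : ∀ r q : ZMod 2, ((if q ≠ 0 then 1 else 0) + if r + q ≠ 0 then 1 else 0 : ℕ) =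
      if r = 0 then (if q = 0 then 0 else 2) else 1 := by decide
  have h : ∀ {m : ℕ} (x : Fin m → ZMod 2), hammingNorm x = ∑ i, if x i ≠ 0 then 1 else 0 :=
    fun x => Finset.card_filter _ _
  rw [h, sum_gray₂ (fun x _ => if x ≠ 0 then 1 else 0) v v, wt, h, ← Finset.sum_add_distrib]
  exact congrArg _ (Finset.sum_congr rfl fun j _ => key _ _)

theorem wt_eq_zero {v : Word α β} (h : wt v = 0) : v = 0 := by
  obtain ⟨h1, h2⟩ := Nat.add_eq_zero_iff.1 h
  rw [Finset.sum_eq_zero_iff] at h2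
  refine Prod.ext (hammingNorm_eq_zero.1 h1) (funext fun j => ?_)
  have := h2 j (Finset.mem_univ j)
  unfold leeWt at this
  split_ifs at this with hr hq
  exact TrivSqZeroExt.ext hr hq

theorem gray_injective : Function.Injective (gray : Word α β →+ _) :=
  (injective_iff_map_eq_zero _).2 fun v hv =>
    wt_eq_zero (by rw [← hammingNorm_gray, hv, hammingNorm_zero])

theorem gray_surjective : Function.Surjective (gray : Word α β →+ _) := by
  intro y
  let z : Fin (α + (β + β)) → ZMod 2 := fun k => y (Fin.cast (by omega) k)
  have hz : ∀ i, y i = z (Fin.cast (by omega) i) := fun i => rfl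
  let q : Fin β → ZMod 2 := fun j => z (Fin.natAdd α (Fin.castAdd β j))
  let v : Word α β := (fun i => z (Fin.castAdd _ i),
    fun j => (z (Fin.natAdd α (Fin.natAdd β j)) - q j, q j))
  refine ⟨v, funext fun i => ?_⟩
  rw [gray_apply, hz, finCongr_apply]
  generalize Fin.cast _ i = k
  refine Fin.addCases (fun k => ?_) (fun k => ?_) k
  · rw [Fin.append_left]
  · refine Fin.addCases (fun k => ?_) (fun k => ?_) k
    · rw [Fin.append_right, Fin.append_left]
      rfl
    · rw [Fin.append_right, Fin.append_right]
      exact sub_add_cancel _ _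

theorem mem_grayImage {C : Code α β} {y : Fin (α + 2 * β) → ZMod 2} :
    y ∈ grayImage C ↔ ∃ v ∈ C, gray v = y := Iff.rfl

theorem innerProd_comm (v w : Word α β) : innerProd v w = innerProd w v := by
  simp only [innerProd, mul_comm]

theorem mem_dual_iff {C : Code α β} {w : Word α β} :
    w ∈ dual C ↔ ∀ v ∈ C, gray w ⬝ᵥ gray v = 0 := by
  constructor
  · intro h v hv
    rw [gray_dotProduct_gray, innerProd_comm, h v hv]
    rfl
  · intro h v hv
    have h1 := h v hv
    have h2 := h _ (C.smul_mem u hv)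
    rw [gray_dotProduct_gray, innerProd_smul] at h2
    rw [gray_dotProduct_gray] at h1
    have h3 : (innerProd w v).fst = 0 := by simpa using h2
    rw [h3, zero_add] at h1
    rw [innerProd_comm]
    exact TrivSqZeroExt.ext h3 h1

theorem grayImage_dual (C : Code α β) : grayImage (dual C) = Quantum.perp (grayImage C) := by
  ext y
  obtain ⟨w, rfl⟩ := gray_surjective y
  rw [Quantum.mem_perp, mem_grayImage]
  constructor
  · rintro ⟨w', hw', h⟩ _ ⟨v, hv, rfl⟩
    exact h ▸ mem_dual_iff.1 hw' v hv
  · exact fun h => ⟨w, mem_dual_iff.2 fun v hv => h _ ⟨v, hv, rfl⟩, rfl⟩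

/-- By counting: `C` and its image under the injective Gray map have the same cardinality, a power
of 2. -/
theorem finrank_grayImage {C : Code α β} {k₀ k₁ k₂ : ℕ} (h : HasType C k₀ k₁ k₂) :
    Module.finrank (ZMod 2) (grayImage C) = k₀ + k₂ + 2 * k₁ := by
  obtain ⟨e⟩ := h
  have h1 : Nat.card (grayImage C) = Nat.card C :=
    (Nat.card_image_of_injective gray_injective (C : Set (Word α β)))
  rw [Nat.card_congr e.toEquiv, Module.natCard_eq_pow_finrank (K := ZMod 2)] at h1
  simp only [Nat.card_prod, Nat.card_fun, Nat.card_zmod, Nat.card_fin, ← pow_add] at h1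
  exact Nat.pow_right_injective le_rfl h1

theorem isLeast_minDist {C : Code α β} (hC : C ≠ ⊥) :
    IsLeast {s | ∃ y ∈ grayImage C, y ≠ 0 ∧ hammingNorm y = s} (minDist C) := by
  have hset : {s | ∃ y ∈ grayImage C, y ≠ 0 ∧ hammingNorm y = s} =
      {d | ∃ v ∈ C, ∃ w ∈ C, v ≠ w ∧ wt (v - w) = d} := by
    ext s
    constructor
    · rintro ⟨_, ⟨v, hv, rfl⟩, h0, rfl⟩
      exact ⟨v, hv, 0, C.zero_mem, fun h => h0 (by simp [h]), by
        rw [sub_zero, hammingNorm_gray]⟩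
    · rintro ⟨v, hv, w, hw, hne, rfl⟩
      refine ⟨_, ⟨v - w, C.sub_mem hv hw, rfl⟩, ?_, hammingNorm_gray _⟩
      rwa [Ne, map_eq_zero_iff _ gray_injective, sub_eq_zero]
  obtain ⟨v, hv, hv0⟩ := C.ne_bot_iff.1 hC
  rw [hset]
  exact ⟨Nat.sInf_mem ⟨_, v, hv, 0, C.zero_mem, hv0, rfl⟩, fun s hs => Nat.sInf_le hs⟩

end Z2Z2u

/-! ### Quantum codes from self-orthogonal `ℤ₂ℤ₂[u]`-codes -/

theorem mainTheorem7 (α β k₀ k₁ k₂ : ℕ) (hpos : 0 < α + β)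
    (C : Z2Z2u.Code α β) (hcyclic : Z2Z2u.IsCyclic C)
    (hself : Z2Z2u.IsSelfOrthogonal C) (htype : Z2Z2u.HasType C k₀ k₁ k₂) :
    2 * (k₀ + k₂ + 2 * k₁) ≤ α + 2 * β ∧
    (∃ Q : Submodule ℂ (Quantum.State (α + 2 * β)),
      Quantum.IsStabilizerCodeWith Q ((α + 2 * β) - 2 * (k₀ + k₂ + 2 * k₁))
        (Z2Z2u.minDist (Z2Z2u.dual C))) ∧
    Z2Z2u.grayImage C ≤ Z2Z2u.grayImage (Z2Z2u.dual C) ∧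
    (∃ d : ℕ, Z2Z2u.minDist (Z2Z2u.dual C) ≤ d ∧
      Quantum.IsStabilizerCodeWith
        (Quantum.cssCode (Z2Z2u.grayImage (Z2Z2u.dual C)) (Z2Z2u.grayImage C))
        ((α + 2 * β) - 2 * (k₀ + k₂ + 2 * k₁)) d) ∧
    Quantum.IsPureTo
      (Quantum.cssCode (Z2Z2u.grayImage (Z2Z2u.dual C)) (Z2Z2u.grayImage C))
      (Z2Z2u.minDist (Z2Z2u.dual C)) := by
  have hle : Z2Z2u.grayImage C ≤ Z2Z2u.grayImage (Z2Z2u.dual C) := by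
    rintro _ ⟨v, hv, rfl⟩
    exact ⟨v, hself hv, rfl⟩
  have hrank := Submodule.finrank_mono hle
  have hK : Module.finrank (ZMod 2) (Z2Z2u.grayImage C) ≤ α + 2 * β :=
    (Submodule.finrank_le _).trans_eq (Module.finrank_fin_fun _)
  have hdual : Module.finrank (ZMod 2) (Z2Z2u.grayImage (Z2Z2u.dual C)) =
      α + 2 * β - Module.finrank (ZMod 2) (Z2Z2u.grayImage C) := by
    rw [Z2Z2u.grayImage_dual, Quantum.finrank_perp]
  -- If the dual were zero, so would be `C`, and the dimension formula would give `α + 2β = 0`. Thus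
  -- `minDist` is a genuine minimum and not the default `sInf ∅ = 0`.
  have hne : Z2Z2u.dual C ≠ ⊥ := fun h => by
    have hbot : Z2Z2u.grayImage (Z2Z2u.dual C) = ⊥ := by
      rw [h, eq_bot_iff]
      rintro _ ⟨v, hv, rfl⟩
      rw [(Submodule.mem_bot Z2Z2u.R).1 hv, map_zero]
      exact Submodule.zero_mem _
    rw [hbot, finrank_bot] at hdual hrank
    omega
  have hleast := Z2Z2u.isLeast_minDist hne
  rw [← Z2Z2u.finrank_grayImage htype]
  refine ⟨by omega, ?_⟩
  rw [Z2Z2u.grayImage_dual] at hle hleast ⊢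
  obtain ⟨hQ, hd⟩ := Quantum.exists_isStabilizerCodeWith_of_le_perp hle hleast
  exact ⟨hQ, hle, hd, Quantum.isPureTo_cssCode_perp hle
    fun v hv hv0 => hleast.2 ⟨v, hv, hv0, rfl⟩⟩
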